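/- Let $\Sigma=\{0,1\}$. A function $d:\Sigma^*\to[0,\infty)$ is a *martingale* if $d(\lambda)=1$ (where $\lambda$ is the empty string) and $d(w)=\frac{d(w0)+d(w1)}{2}$ for every string $w$; it is a *supermartingale* if $d(w)\ge\frac{d(w0)+d(w1)}{2}$ for every string $w$. It is *computably enumerable* (c.e.) if there is a Turing machine $M:\Sigma^*\times\mathbb N\to\mathbb Q$ such that, for every $w$, the sequence $M(w,n)$ converges to $d(w)$ monotonically from below. It *succeeds* on $X\in\Sigma^\infty$ if $\limsup_{n\to\infty} d(X\upharpoonright n)=\infty$, where $X\upharpoonright n$ denotes the string of the first $n$ bits of $X$. A *c.e. oracle martingale* (respectively *oracle supermartingale*) is a family $(d^Y)_{Y\in\Sigma^\infty}$ of martingales (respectively supermartingales) for which there is one oracle Turing machine $M$ such that, for every oracle $Y$ and every string $w$, the rationals $M^Y(w,n)$ are defined for all $n$ and converge to $d^Y(w)$ monotonically from below as $n\to\infty$. A sequence $X\in\Sigma^\infty$ is *Martin-Löf random* if no c.e. martingale or supermartingale succeeds on $X$. It is *Martin-Löf random relative to* $Y\in\Sigma^\infty$ if there is no c.e. oracle martingale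 or oracle supermartingale $d$ such that $d^Y$ succeeds on $X$. For $A,B\in\Sigma^\infty$ let $A\uplus B=A_0B_0A_1B_1\dots$ be the sequence that interleaves the bits of $A$ and $B$. **Lemma.** Let $A,B\in\Sigma^\infty$. If $A\uplus B$ is not Martin-Löf random, then $B$ is not Martin-Löf random or $A$ is not Martin-Löf random relative to $B$. -/

import Mathlib

open Filter Topology
open scoped NNReal ENNReal

namespace VanLambalgen

/-- Infinite binary sequences; finite binary strings are `List Bool`. -/
abbrev BinSeq : Type := ℕ → Bool

/-- The string `X₀ X₁ … Xₙ₋₁`. -/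
def initSeg (X : BinSeq) (n : ℕ) : List Bool := (List.range n).map X

/-- The interleaving `A₀ B₀ A₁ B₁ …`. -/
def interleave (A B : BinSeq) : BinSeq := fun n => if n % 2 = 0 then A (n / 2) else B (n / 2)

/-- `d(λ) = 1` and `d(w) = (d(w0) + d(w1)) / 2` for every string `w`. -/
def IsMartingale (d : List Bool → ℝ≥0) : Prop :=
  d [] = 1 ∧ ∀ w, d w = (d (w ++ [false]) + d (w ++ [true])) / 2

/-- `d(w) ≥ (d(w0) + d(w1)) / 2` for every string `w`. -/
def IsSupermartingale (d : List Bool → ℝ≥0) : Prop :=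
  ∀ w, (d (w ++ [false]) + d (w ++ [true])) / 2 ≤ d w

/-- The limit superior of the values of `d` along the initial segments of `X` is infinite. -/
def Succeeds (d : List Bool → ℝ≥0) (X : BinSeq) : Prop :=
  limsup (fun n => (d (initSeg X n) : ℝ≥0∞)) atTop = ⊤

/-- The rational `a / (b + 1)` that a machine presents by outputting the pair `(a, b)`. -/
def ratValue (p : ℤ × ℕ) : ℚ := (p.1 : ℚ) / ((p.2 : ℚ) + 1)

/-- For every `w`, the rationals presented by `M w 0, M w 1, …` converge to `d w`
monotonically from below. -/
def ApproximatesFromBelow (M : List Bool → ℕ → ℤ × ℕ) (d : List Bool → ℝ≥0) : Prop :=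
  ∀ w, Monotone (fun n => ratValue (M w n)) ∧
    Tendsto (fun n => (ratValue (M w n) : ℝ)) atTop (𝓝 (d w : ℝ))

/-- `d` is computably enumerable: a machine computes rational approximations that converge to `d`
monotonically from below. -/
def IsCE (d : List Bool → ℝ≥0) : Prop :=
  ∃ M : List Bool → ℕ → ℤ × ℕ, Computable₂ M ∧ ApproximatesFromBelow M d

/-- Programs for oracle machines on the natural numbers, one constructor for each closure rule of
`Nat.RecursiveIn`. -/
inductive OracleCode : Type
  | zero : OracleCode
  | succ : OracleCode
  | left : OracleCode
  | right : OracleCode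
  | oracle : OracleCode
  | pair : OracleCode → OracleCode → OracleCode
  | comp : OracleCode → OracleCode → OracleCode
  | prec : OracleCode → OracleCode → OracleCode
  | rfind : OracleCode → OracleCode

/-- The partial function computed by an oracle program with the sequence `Y` as its oracle; the
query `n` is answered by the bit `Y n`. -/
def OracleCode.eval (Y : BinSeq) : OracleCode → ℕ →. ℕ
  | .zero => fun _ => Part.some 0
  | .succ => fun n => Part.some (n + 1)
  | .left => fun n => Part.some (Nat.unpair n).1
  | .right => fun n => Part.some (Nat.unpair n).2
  | .oracle => fun n => Part.some (Y n).toNat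
  | .pair f h => fun n => Nat.pair <$> OracleCode.eval Y f n <*> OracleCode.eval Y h n
  | .comp f h => fun n => OracleCode.eval Y h n >>= OracleCode.eval Y f
  | .prec f h => fun p =>
      let (a, n) := Nat.unpair p
      n.rec (OracleCode.eval Y f a) fun y IH => do
        let i ← IH
        OracleCode.eval Y h (Nat.pair a (Nat.pair y i))
  | .rfind f => fun a =>
      Nat.rfind fun n => (fun m => m = 0) <$> OracleCode.eval Y f (Nat.pair a n)

/-- A family `d = (d^Y)` is computably enumerable with an oracle: a single oracle program computes,
with each oracle `Y`, rational approximations that converge to `d^Y` monotonically from below. -/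
def IsOracleCE (d : BinSeq → List Bool → ℝ≥0) : Prop :=
  ∃ (c : OracleCode) (M : BinSeq → List Bool → ℕ → ℤ × ℕ),
    (∀ Y w n, c.eval Y (Encodable.encode (w, n)) = Part.some (Encodable.encode (M Y w n))) ∧
    ∀ Y, ApproximatesFromBelow (M Y) (d Y)

/-- No computably enumerable martingale or supermartingale succeeds on `X`. -/
def MLRandom (X : BinSeq) : Prop :=
  ¬ ∃ d : List Bool → ℝ≥0,
    (IsMartingale d ∨ IsSupermartingale d) ∧ IsCE d ∧ Succeeds d X

/-- No computably enumerable oracle martingale or oracle supermartingale `d` has a `d^Y` that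
succeeds on `X`. -/
def MLRandomRelativeTo (X Y : BinSeq) : Prop :=
  ¬ ∃ d : BinSeq → List Bool → ℝ≥0,
    ((∀ Z, IsMartingale (d Z)) ∨ (∀ Z, IsSupermartingale (d Z))) ∧ IsOracleCE d ∧
      Succeeds (d Y) X

end VanLambalgen

namespace VanLambalgen

/-! Let `d` be a c.e. supermartingale that succeeds on the interleaving of `A` and `B`. It is first
traded for a computable integer-valued `f`, nondecreasing under extension, unbounded along that
sequence, and with bounded averages over the strings of each length. This `f` is `approxMaxLog`, the
logarithm of the largest value of `d` detected so far. Passing to the logarithm keeps the averages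
bounded (`extSum_maxLog_le`), which the maximum itself need not do. Conversely, the averages of any
such `f` over longer and longer extensions increase to a c.e. supermartingale that dominates `f`
(`limitAverage`).

Now average `f` over the first coordinate only. Since `f` is computable, so are these fiber
averages, and they increase with the second string. If they are unbounded along `B`, their integer
parts form a function of the same kind, and `B` is not random. If they are bounded by some `c` along
`B`, then with `B` fixed `f` has bounded averages in the first coordinate and is unbounded along
`A`, so `A` is not random relative to `B`. The oracle family must consist of supermartingales for
every oracle, so `fiberValue` freezes `f` at the last length where the fiber average is at most `c`.
For the oracle `B` nothing is frozen. -/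

/-! ### Sums over the extensions of a string -/

/-- The sum of `f` over all extensions of `w` by `n` bits. -/
def extSum (f : List Bool → ℕ) : ℕ → List Bool → ℕ
  | 0, w => f w
  | n + 1, w => extSum f n (w ++ [false]) + extSum f n (w ++ [true])

theorem extSum_mono {f g : List Bool → ℕ} (n : ℕ) (w : List Bool)
    (h : ∀ x : List Bool, x.length = w.length + n → f x ≤ g x) : extSum f n w ≤ extSum g n w := by
  induction n generalizing w with
  | zero => exact h w rfl
  | succ n ih =>
    refine Nat.add_le_add (ih _ fun x hx => h x ?_) (ih _ fun x hx => h x ?_) <;>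
    · simp at hx; omega

theorem extSum_congr {f g : List Bool → ℕ} (n : ℕ) (w : List Bool)
    (h : ∀ x : List Bool, x.length = w.length + n → f x = g x) : extSum f n w = extSum g n w :=
  le_antisymm (extSum_mono n w fun x hx => (h x hx).le) (extSum_mono n w fun x hx => (h x hx).ge)

theorem extSum_add (f g : List Bool → ℕ) (n : ℕ) (w : List Bool) :
    extSum (fun x => f x + g x) n w = extSum f n w + extSum g n w := by
  induction n generalizing w with
  | zero => rfl
  | succ n ih => simp only [extSum, ih]; omega

theorem extSum_succ (f : List Bool → ℕ) (n : ℕ) (w : List Bool) :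
    extSum f (n + 1) w = extSum (fun x => f (x ++ [false]) + f (x ++ [true])) n w := by
  induction n generalizing w with
  | zero => rfl
  | succ n ih => rw [extSum, ih, ih]; rfl

theorem extSum_mul_const (f : List Bool → ℕ) (c n : ℕ) (w : List Bool) :
    extSum (fun x => f x * c) n w = extSum f n w * c := by
  induction n generalizing w with
  | zero => rfl
  | succ n ih => simp only [extSum, ih]; ring

theorem extSum_le_extSum_nil (f : List Bool → ℕ) (w : List Bool) (n : ℕ) :
    extSum f n w ≤ extSum f (n + w.length) [] := by
  induction w using List.reverseRecOn generalizing n with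
  | nil => simp
  | append_singleton w b ih =>
    have h : extSum f n (w ++ [b]) ≤ extSum f (n + 1) w := by cases b <;> simp [extSum]
    refine h.trans ((ih _).trans_eq ?_)
    congr 1
    simp; omega

theorem two_mul_extSum_le {f : List Bool → ℕ} (hf : ∀ w b, f w ≤ f (w ++ [b])) (n : ℕ)
    (w : List Bool) : 2 * extSum f n w ≤ extSum f (n + 1) w := by
  rw [extSum_succ, extSum_add, two_mul]
  exact Nat.add_le_add (extSum_mono _ _ fun _ _ => hf _ _) (extSum_mono _ _ fun _ _ => hf _ _)

theorem extSum_take (g : List Bool → ℕ) (m k : ℕ) :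
    extSum (fun u => g (u.take m)) (m + k) [] = 2 ^ k * extSum g m [] := by
  induction k with
  | zero =>
    simp only [add_zero, pow_zero, one_mul]
    refine extSum_congr _ _ fun x hx => ?_
    rw [List.take_of_length_le]
    simp at hx; omega
  | succ k ih =>
    have h : extSum (fun x => g ((x ++ [false]).take m) + g ((x ++ [true]).take m)) (m + k) [] =
        extSum (fun x => g (x.take m) + g (x.take m)) (m + k) [] := by
      refine extSum_congr _ _ fun x hx => ?_
      have : m ≤ x.length := by simp at hx; omega
      rw [List.take_append_of_le_length this, List.take_append_of_le_length this]
    rw [← add_assoc, extSum_succ, h, extSum_add, ih]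
    ring

/-- The string of the first `n` binary digits of `i`, least significant digit first. -/
def bits (n i : ℕ) : List Bool := (List.range n).map fun j => i / 2 ^ j % 2 == 1

theorem bits_succ (n i : ℕ) : bits (n + 1) i = (i % 2 == 1) :: bits n (i / 2) := by
  simp [bits, List.range_succ_eq_map, Function.comp_def, pow_succ', Nat.div_div_eq_div_mul]

theorem sum_range_two_mul (g : ℕ → ℕ) (m : ℕ) :
    ∑ i ∈ Finset.range (2 * m), g i =
      ∑ i ∈ Finset.range m, g (2 * i) + ∑ i ∈ Finset.range m, g (2 * i + 1) := by
  induction m with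
  | zero => rfl
  | succ m ih =>
    rw [mul_add_one, Finset.sum_range_succ, Finset.sum_range_succ, ih, Finset.sum_range_succ,
      Finset.sum_range_succ]
    ring

/-- The recursion for `extSum` changes `w`; a flat sum over indices can instead be computed by plain
primitive recursion. -/
theorem extSum_eq_sum_bits (f : List Bool → ℕ) (n : ℕ) (w : List Bool) :
    extSum f n w = ∑ i ∈ Finset.range (2 ^ n), f (w ++ bits n i) := by
  induction n generalizing w with
  | zero => simp [extSum, bits]
  | succ n ih =>
    have h (i : ℕ) : (2 * i + 1) / 2 = i := by omega
    rw [extSum, ih, ih, pow_succ', sum_range_two_mul]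
    simp [bits_succ, h, Nat.add_mod]

/-! ### From monotone functions with bounded averages to supermartingales -/

/-- The martingale whose value at `w` is the limit of the averages of `f` over the extensions of
`w` by `n` bits. -/
noncomputable def limitAverage (f : List Bool → ℕ) (w : List Bool) : ℝ≥0 :=
  ⨆ n, (extSum f n w : ℝ≥0) / 2 ^ n

theorem monotone_average {f : List Bool → ℕ} (hf : ∀ w b, f w ≤ f (w ++ [b])) (w : List Bool) :
    Monotone fun n => (extSum f n w : ℝ≥0) / 2 ^ n := by
  refine monotone_nat_of_le_succ fun n => ?_
  rw [div_le_div_iff₀ (by positivity) (by positivity)]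
  have h := two_mul_extSum_le hf n w
  have h' : (2 * extSum f n w : ℝ≥0) ≤ extSum f (n + 1) w := by exact_mod_cast h
  calc (extSum f n w : ℝ≥0) * 2 ^ (n + 1) = (2 * extSum f n w) * 2 ^ n := by ring
    _ ≤ _ := by gcongr

theorem bddAbove_average {f : List Bool → ℕ} {C : ℕ} (hC : ∀ n, extSum f n [] ≤ C * 2 ^ n)
    (w : List Bool) : BddAbove (Set.range fun n => (extSum f n w : ℝ≥0) / 2 ^ n) := by
  refine ⟨C * 2 ^ w.length, ?_⟩
  rintro _ ⟨n, rfl⟩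
  rw [div_le_iff₀ (by positivity)]
  have h := (extSum_le_extSum_nil f w n).trans (hC _)
  calc (extSum f n w : ℝ≥0) ≤ C * 2 ^ (n + w.length) := by exact_mod_cast h
    _ = _ := by ring

theorem tendsto_limitAverage {f : List Bool → ℕ} (hf : ∀ w b, f w ≤ f (w ++ [b])) {C : ℕ}
    (hC : ∀ n, extSum f n [] ≤ C * 2 ^ n) (w : List Bool) :
    Tendsto (fun n => (extSum f n w : ℝ≥0) / 2 ^ n) atTop (𝓝 (limitAverage f w)) :=
  tendsto_atTop_ciSup (monotone_average hf w) (bddAbove_average hC w)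

/-- The average at depth `n + 1` below `w` is the mean of the two averages at depth `n` below its
children, so the inequality is an equality in the limit. -/
theorem isSupermartingale_limitAverage {f : List Bool → ℕ} (hf : ∀ w b, f w ≤ f (w ++ [b])) {C : ℕ}
    (hC : ∀ n, extSum f n [] ≤ C * 2 ^ n) : IsSupermartingale (limitAverage f) := by
  intro w
  refine le_of_eq (tendsto_nhds_unique ?_
    ((tendsto_add_atTop_iff_nat 1).2 (tendsto_limitAverage hf hC w)))
  refine (((tendsto_limitAverage hf hC (w ++ [false])).add
    (tendsto_limitAverage hf hC (w ++ [true]))).div_const 2).congr fun n => ?_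
  rw [extSum]
  push_cast
  field_simp
  ring

theorem le_limitAverage {f : List Bool → ℕ} {C : ℕ} (hC : ∀ n, extSum f n [] ≤ C * 2 ^ n)
    (w : List Bool) : (f w : ℝ≥0) ≤ limitAverage f w := by
  have h := le_ciSup (bddAbove_average hC w) 0
  simpa [extSum, limitAverage] using h

theorem initSeg_succ (X : BinSeq) (n : ℕ) : initSeg X (n + 1) = initSeg X n ++ [X n] := by
  simp [initSeg, List.range_succ]

@[simp]
theorem length_initSeg (X : BinSeq) (n : ℕ) : (initSeg X n).length = n := by simp [initSeg]

theorem initSeg_congr {X Z : BinSeq} {n : ℕ} (h : ∀ i < n, X i = Z i) :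
    initSeg X n = initSeg Z n := by
  simpa [initSeg] using h

theorem take_initSeg (X : BinSeq) {m n : ℕ} (h : m ≤ n) :
    (initSeg X n).take m = initSeg X m := by
  simp [initSeg, ← List.map_take, List.take_range, h]

/-- Since `f` is nondecreasing along `X`, one large value bounds all later ones from below, hence
also the limsup. -/
theorem succeeds_limitAverage {f : List Bool → ℕ} (hf : ∀ w b, f w ≤ f (w ++ [b])) {C : ℕ}
    (hC : ∀ n, extSum f n [] ≤ C * 2 ^ n) {X : BinSeq} (hX : ∀ c, ∃ n, c < f (initSeg X n)) :
    Succeeds (limitAverage f) X := by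
  have hmono : Monotone fun n => f (initSeg X n) :=
    monotone_nat_of_le_succ fun n => by rw [initSeg_succ]; exact hf _ _
  refine ENNReal.eq_top_of_forall_nnreal_le fun r => ?_
  obtain ⟨c, hc⟩ := exists_nat_ge r
  obtain ⟨n, hn⟩ := hX c
  refine le_limsup_of_le (by isBoundedDefault) fun b hb => ?_
  obtain ⟨m, hm, hnm⟩ := (hb.and (eventually_ge_atTop n)).exists
  refine le_trans ?_ hm
  rw [ENNReal.coe_le_coe]
  refine hc.trans (le_trans ?_ (le_limitAverage hC _))
  exact_mod_cast hn.le.trans (hmono hnm)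

theorem Succeeds.exists_lt {d : List Bool → ℝ≥0} {X : BinSeq} (h : Succeeds d X) (c : ℝ≥0) :
    ∃ n, c < d (initSeg X n) := by
  have h' : (c : ℝ≥0∞) < limsup (fun n => (d (initSeg X n) : ℝ≥0∞)) atTop := by
    rw [h]; exact ENNReal.coe_lt_top
  obtain ⟨n, hn⟩ := (frequently_lt_of_lt_limsup (by isBoundedDefault) h').exists
  exact ⟨n, by exact_mod_cast hn⟩

theorem IsMartingale.isSupermartingale {d : List Bool → ℝ≥0} (h : IsMartingale d) :
    IsSupermartingale d := fun w => (h.2 w).ge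

/-! ### The logarithm of the running maximum has bounded averages -/

/-- The largest `k` such that `d` reaches `2 ^ k` on a prefix of `w`. -/
noncomputable def maxLog (d : List Bool → ℝ≥0) (w : List Bool) : ℕ :=
  (Finset.range (w.length + 1)).sup fun j => Nat.log 2 ⌊d (w.take j)⌋₊

theorem maxLog_append (d : List Bool → ℝ≥0) (w : List Bool) (b : Bool) :
    maxLog d (w ++ [b]) = max (maxLog d w) (Nat.log 2 ⌊d (w ++ [b])⌋₊) := by
  unfold maxLog
  rw [List.length_append, List.length_singleton, Finset.range_add_one, Finset.sup_insert, max_comm]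
  refine congrArg₂ max (Finset.sup_congr rfl fun j hj => ?_) ?_
  · rw [List.take_append_of_le_length]
    simp at hj; omega
  · rw [List.take_of_length_le (by simp)]

/-- If the maximum jumps from `k` to `k + r`, then `y = d / 2 ^ (k + r)` is at least 1. The first
term gains `r`, while the second falls from `2 ^ r * y` to `y`, a loss of at least `2 ^ r - 1 ≥ r`.
-/
theorem maxLog_potential_append_le (d : List Bool → ℝ≥0) (w : List Bool) (b : Bool) :
    (maxLog d (w ++ [b]) : ℝ) + d (w ++ [b]) / 2 ^ maxLog d (w ++ [b]) ≤
      maxLog d w + d (w ++ [b]) / 2 ^ maxLog d w := by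
  rw [maxLog_append]
  generalize maxLog d w = k
  generalize d (w ++ [b]) = x
  rcases le_or_gt (Nat.log 2 ⌊x⌋₊) k with h | h
  · rw [max_eq_left h]
  · rw [max_eq_right h.le]
    obtain ⟨r, hr⟩ := Nat.exists_eq_add_of_le h.le
    have hx : ⌊x⌋₊ ≠ 0 := by
      intro h0
      simp [h0] at h
    have h1 : (2 : ℝ) ^ Nat.log 2 ⌊x⌋₊ ≤ x := by
      have h2 : (2 ^ Nat.log 2 ⌊x⌋₊ : ℕ) ≤ ⌊x⌋₊ := Nat.pow_log_le_self 2 hx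
      have h3 := (Nat.le_floor_iff (zero_le (a := x))).1 h2
      exact_mod_cast h3
    rw [hr] at h1 ⊢
    have h4 : (1 : ℝ) ≤ x / 2 ^ (k + r) := by rwa [one_le_div (by positivity)]
    have h5 : (x : ℝ) / 2 ^ k = 2 ^ r * (x / 2 ^ (k + r)) := by rw [pow_add]; field_simp
    have h6 : (r : ℝ) + 1 ≤ 2 ^ r := by exact_mod_cast Nat.lt_two_pow_self (n := r)
    rw [h5]
    push_cast
    nlinarith

/-- The potential `maxLog d + d / 2 ^ maxLog d` does not increase on average and lies above `maxLog
d`. -/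
theorem extSum_maxLog_le {d : List Bool → ℝ≥0} (hd : IsSupermartingale d) (n : ℕ) (w : List Bool) :
    (extSum (maxLog d) n w : ℝ) ≤ 2 ^ n * (maxLog d w + d w / 2 ^ maxLog d w) := by
  induction n generalizing w with
  | zero => simp [extSum]; positivity
  | succ n ih =>
    have h0 := (ih (w ++ [false])).trans
      (mul_le_mul_of_nonneg_left (maxLog_potential_append_le d w false) (by positivity))
    have h1 := (ih (w ++ [true])).trans
      (mul_le_mul_of_nonneg_left (maxLog_potential_append_le d w true) (by positivity))
    have h2 : ((d (w ++ [false]) : ℝ) + d (w ++ [true])) / 2 ≤ d w := by exact_mod_cast hd w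
    rw [extSum]
    push_cast
    refine (add_le_add h0 h1).trans ?_
    rw [← mul_add, pow_succ, mul_assoc]
    refine mul_le_mul_of_nonneg_left ?_ (by positivity)
    have h3 : ((d (w ++ [false]) : ℝ) + d (w ++ [true])) / 2 ^ maxLog d w ≤
        2 * d w / 2 ^ maxLog d w := by
      gcongr
      linarith
    rw [add_div] at h3
    rw [mul_add, ← mul_div_assoc]
    linarith

/-! ### Computability of the constructions -/

section Computability

variable {α β : Type*} [Primcodable α] [Primcodable β]

theorem primrec₂_pow : Primrec₂ ((· ^ ·) : ℕ → ℕ → ℕ) := Primrec₂.unpaired'.1 Nat.Primrec.pow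

theorem primrec_toNat : Primrec Int.toNat := by
  -- The encoding of integers sends `n ≥ 0` to `2 * n` and negative integers to odd numbers.
  have h : Primrec fun z : ℤ =>
      if Encodable.encode z % 2 = 0 then Encodable.encode z / 2 else 0 :=
    Primrec.ite (Primrec.eq.comp (Primrec.nat_mod.comp Primrec.encode (Primrec.const 2))
      (Primrec.const 0)) (Primrec.nat_div.comp Primrec.encode (Primrec.const 2)) (Primrec.const 0)
  refine h.of_eq fun z => ?_
  rcases z with n | n
  · have : Encodable.encode (Int.ofNat n) = 2 * n := rfl
    rw [this]; simp
  · have : Encodable.encode (Int.negSucc n) = 2 * n + 1 := rfl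
    rw [this, if_neg (by omega)]; rfl

theorem primrec_ofNat : Primrec Int.ofNat :=
  Primrec.encode_iff.1 (Primrec.nat_double.of_eq fun _ => rfl)

theorem primrec_natLog_two : Primrec (Nat.log 2) := by
  have h : Primrec fun q : ℕ => Nat.findGreatest (fun k => 2 ^ k ≤ q) q :=
    Primrec.nat_findGreatest Primrec.id
      (Primrec.nat_le.comp (primrec₂_pow.comp (Primrec.const 2) Primrec.snd) Primrec.fst)
  refine h.of_eq fun q => ?_
  rcases eq_or_ne q 0 with rfl | hq
  · simp
  · rw [Nat.findGreatest_eq_iff]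
    refine ⟨Nat.log_le_self _ _, fun _ => Nat.pow_log_le_self 2 hq, fun n hn _ => ?_⟩
    exact not_le.2 (Nat.lt_pow_of_log_lt (by norm_num) hn)

theorem primrec_initSeg {f : α → BinSeq} {n : α → ℕ} (hf : Primrec₂ f) (hn : Primrec n) :
    Primrec fun a => initSeg (f a) (n a) :=
  Primrec.list_map (Primrec.list_range.comp hn) hf

theorem primrec₂_bits : Primrec₂ bits := by
  refine Primrec.list_map (Primrec.list_range.comp Primrec.fst) ?_
  exact Primrec.beq.comp (Primrec.nat_mod.comp (Primrec.nat_div.comp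
    (Primrec.snd.comp Primrec.fst) (primrec₂_pow.comp (Primrec.const 2) Primrec.snd))
    (Primrec.const 2)) (Primrec.const 1)

theorem computable_sum {f : α → ℕ} {g : α → ℕ → ℕ} (hf : Computable f) (hg : Computable₂ g) :
    Computable fun a => ∑ i ∈ Finset.range (f a), g a i := by
  have h : Computable₂ fun (a : α) (p : ℕ × ℕ) => p.2 + g a p.1 :=
    Primrec.nat_add.to_comp.comp (Computable.snd.comp Computable.snd)
      (hg.comp Computable.fst (Computable.fst.comp Computable.snd))
  refine (Computable.nat_rec hf (Computable.const 0) h).of_eq fun a => ?_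
  induction f a with
  | zero => rfl
  | succ n ih => rw [Finset.sum_range_succ, ← ih]

theorem computable_sup {f : α → ℕ} {g : α → ℕ → ℕ} (hf : Computable f) (hg : Computable₂ g) :
    Computable fun a => (Finset.range (f a)).sup (g a) := by
  have h : Computable₂ fun (a : α) (p : ℕ × ℕ) => max (g a p.1) p.2 :=
    Primrec.nat_max.to_comp.comp (hg.comp Computable.fst (Computable.fst.comp Computable.snd))
      (Computable.snd.comp Computable.snd)
  refine (Computable.nat_rec hf (Computable.const 0) h).of_eq fun a => ?_
  induction f a with
  | zero => rfl
  | succ n ih => rw [Finset.range_add_one, Finset.sup_insert, ← ih]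

theorem computable_extSum {f : α → List Bool → ℕ} {n : α → ℕ} {w : α → List Bool}
    (hf : Computable₂ f) (hn : Computable n) (hw : Computable w) :
    Computable fun a => extSum (f a) (n a) (w a) := by
  have h : Computable₂ fun (a : α) (i : ℕ) => f a (w a ++ bits (n a) i) :=
    hf.comp Computable.fst (Computable.list_append.comp (hw.comp Computable.fst)
      (primrec₂_bits.to_comp.comp (hn.comp Computable.fst) Computable.snd))
  exact (computable_sum (primrec₂_pow.to_comp.comp (Computable.const 2) hn) h).of_eq
    fun a => (extSum_eq_sum_bits _ _ _).symm

/-- A pair presenting the rational `extSum f n w / 2 ^ n`. -/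
def averageCode (f : List Bool → ℕ) (w : List Bool) (n : ℕ) : ℤ × ℕ :=
  (Int.ofNat (extSum f n w), 2 ^ n - 1)

theorem ratValue_averageCode (f : List Bool → ℕ) (w : List Bool) (n : ℕ) :
    (ratValue (averageCode f w n) : ℝ) = ((extSum f n w : ℝ≥0) / 2 ^ n : ℝ≥0) := by
  simp [ratValue, averageCode]

theorem approximatesFromBelow_averageCode {f : List Bool → ℕ} (hf : ∀ w b, f w ≤ f (w ++ [b]))
    {C : ℕ} (hC : ∀ n, extSum f n [] ≤ C * 2 ^ n) :
    ApproximatesFromBelow (averageCode f) (limitAverage f) := by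
  refine fun w => ⟨fun m n hmn => ?_, ?_⟩
  · have h : (ratValue (averageCode f w m) : ℝ) ≤ ratValue (averageCode f w n) := by
      rw [ratValue_averageCode, ratValue_averageCode]
      exact_mod_cast monotone_average hf w hmn
    exact_mod_cast h
  · simp only [ratValue_averageCode]
    exact NNReal.tendsto_coe.2 (tendsto_limitAverage hf hC w)

theorem computable_averageCode {f : α → List Bool → ℕ} {w : α → List Bool} {n : α → ℕ}
    (hf : Computable₂ f) (hw : Computable w) (hn : Computable n) :
    Computable fun a => averageCode (f a) (w a) (n a) :=
  Computable.pair (primrec_ofNat.to_comp.comp (computable_extSum hf hn hw))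
    (Primrec.nat_sub.to_comp.comp (primrec₂_pow.to_comp.comp (Computable.const 2) hn)
      (Computable.const 1))

theorem isCE_limitAverage {f : List Bool → ℕ} (hc : Computable f)
    (hf : ∀ w b, f w ≤ f (w ++ [b])) {C : ℕ} (hC : ∀ n, extSum f n [] ≤ C * 2 ^ n) :
    IsCE (limitAverage f) :=
  ⟨averageCode f, computable_averageCode (hc.comp Computable.snd).to₂ Computable.fst Computable.snd,
    approximatesFromBelow_averageCode hf hC⟩

/-! ### Oracle programs -/

theorem OracleCode.eval_comp_of_eq {Y : BinSeq} {e : OracleCode} {n m : ℕ} (c : OracleCode)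
    (h : e.eval Y n = Part.some m) : (OracleCode.comp c e).eval Y n = c.eval Y m := by
  change Part.bind (e.eval Y n) (c.eval Y) = _
  rw [h]
  exact Part.bind_some _ _

theorem OracleCode.eval_pair_of_eq {Y : BinSeq} {c e : OracleCode} {n a b : ℕ}
    (hc : c.eval Y n = Part.some a) (he : e.eval Y n = Part.some b) :
    (OracleCode.pair c e).eval Y n = Part.some (Nat.pair a b) := by
  simp [OracleCode.eval, hc, he, Seq.seq]

theorem OracleCode.eval_pair_left_right (Y : BinSeq) (n : ℕ) :
    (OracleCode.pair .left .right).eval Y n = Part.some n := by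
  rw [OracleCode.eval_pair_of_eq rfl rfl, Nat.pair_unpair]

/-- An oracle program that ignores its oracle. -/
theorem exists_oracleCode_of_partrec {f : ℕ →. ℕ} (hf : Nat.Partrec f) :
    ∃ c : OracleCode, ∀ Y, c.eval Y = f := by
  induction hf with
  | zero => exact ⟨.zero, fun _ => rfl⟩
  | succ => exact ⟨.succ, fun _ => rfl⟩
  | left => exact ⟨.left, fun _ => rfl⟩
  | right => exact ⟨.right, fun _ => rfl⟩
  | pair _ _ ihf ihg =>
    obtain ⟨c, hc⟩ := ihf
    obtain ⟨e, he⟩ := ihg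
    exact ⟨.pair c e, fun Y => by simp only [OracleCode.eval, hc, he]; rfl⟩
  | comp _ _ ihf ihg =>
    obtain ⟨c, hc⟩ := ihf
    obtain ⟨e, he⟩ := ihg
    exact ⟨.comp c e, fun Y => by simp only [OracleCode.eval, hc, he]; rfl⟩
  | prec _ _ ihf ihg =>
    obtain ⟨c, hc⟩ := ihf
    obtain ⟨e, he⟩ := ihg
    exact ⟨.prec c e, fun Y => by simp only [OracleCode.eval, hc, he]; rfl⟩
  | rfind _ ihf =>
    obtain ⟨c, hc⟩ := ihf
    exact ⟨.rfind c, fun Y => by simp only [OracleCode.eval, hc]; rfl⟩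

theorem exists_oracleCode_of_computable {f : α → β} (hf : Computable f) :
    ∃ c : OracleCode, ∀ Y a, c.eval Y (Encodable.encode a) = Part.some (Encodable.encode (f a)) := by
  obtain ⟨c, hc⟩ := exists_oracleCode_of_partrec hf
  exact ⟨c, fun Y a => by simp [hc]⟩

/-- An oracle program that reads off an initial segment of the oracle. -/
theorem exists_oracleCode_initSeg :
    ∃ c : OracleCode, ∀ Y n,
      c.eval Y n = Part.some (Encodable.encode (initSeg Y n).reverse) := by
  -- The code of `b :: l` is the successor of a pair, so each recursion step prepends the newest
  -- oracle bit; hence the reversed list.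
  refine ⟨.comp (.prec .zero (.comp .succ (.pair (.comp .oracle (.comp .left .right))
    (.comp .right .right)))) (.pair .zero (.pair .left .right)), fun Y n => ?_⟩
  rw [OracleCode.eval_comp_of_eq _
    (OracleCode.eval_pair_of_eq rfl (OracleCode.eval_pair_left_right Y n))]
  simp only [OracleCode.eval, Nat.unpair_pair]
  induction n with
  | zero => rfl
  | succ n ih =>
    have he (b : Bool) : Encodable.encode b = b.toNat := by cases b <;> rfl
    simp only [ih]
    simp [Seq.seq, initSeg_succ, he]

/-- The infinite sequence that starts with `y` and continues with zeros. -/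
def padZeros (y : List Bool) : BinSeq := fun i => y.getD i false

theorem padZeros_initSeg (Y : BinSeq) {n i : ℕ} (h : i < n) : padZeros (initSeg Y n) i = Y i := by
  simp [padZeros, initSeg, h]

theorem primrec₂_padZeros : Primrec₂ padZeros := Primrec.list_getD false

/-- By `hloc`, averaging over extensions of `w` by `n` bits uses only the first `|w| + n` oracle
bits. The program reads these and passes them to an oracle-free computation. -/
theorem isOracleCE_limitAverage {f : BinSeq → List Bool → ℕ}
    (hc : Computable₂ fun y u => f (padZeros y) u)
    (hloc : ∀ Y Z u, (∀ i < u.length, Y i = Z i) → f Y u = f Z u)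
    (hf : ∀ Y w b, f Y w ≤ f Y (w ++ [b])) {C : ℕ} (hC : ∀ Y n, extSum (f Y) n [] ≤ C * 2 ^ n) :
    IsOracleCE fun Y => limitAverage (f Y) := by
  have hF : Computable fun p : List Bool × (List Bool × ℕ) =>
      averageCode (f (padZeros p.1.reverse)) p.2.1 p.2.2 :=
    computable_averageCode
      (hc.comp (Computable.list_reverse.comp (Computable.fst.comp Computable.fst)) Computable.snd).to₂
      (Computable.fst.comp Computable.snd) (Computable.snd.comp Computable.snd)
  have hL : Computable fun p : List Bool × ℕ => p.1.length + p.2 :=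
    Primrec.nat_add.to_comp.comp (Computable.list_length.comp Computable.fst) Computable.snd
  obtain ⟨cF, hcF⟩ := exists_oracleCode_of_computable hF
  obtain ⟨cL, hcL⟩ := exists_oracleCode_of_computable hL
  obtain ⟨cI, hcI⟩ := exists_oracleCode_initSeg
  refine ⟨.comp cF (.pair (.comp cI cL) (.pair .left .right)), fun Y => averageCode (f Y),
    fun Y w n => ?_, fun Y => approximatesFromBelow_averageCode (hf Y) (hC Y)⟩
  have h := hcF Y ((initSeg Y (w.length + n)).reverse, (w, n))
  have hn := hcL Y (w, n)
  rw [List.reverse_reverse] at h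
  have he : averageCode (f (padZeros (initSeg Y (w.length + n)))) w n = averageCode (f Y) w n := by
    unfold averageCode
    rw [extSum_congr n w fun x hx => hloc _ Y x fun i hi => padZeros_initSeg Y (hx ▸ hi)]
  simp only [he] at h
  rw [← h]
  refine OracleCode.eval_comp_of_eq _ (OracleCode.eval_pair_of_eq ?_
    (OracleCode.eval_pair_left_right Y _))
  rw [OracleCode.eval_comp_of_eq _ hn]
  exact hcI Y _

end Computability

/-! ### Interleaving and averages over fibers -/

/-- The interleaving of two strings of equal length. -/
def interleaveList (u v : List Bool) : List Bool :=
  initSeg (interleave (padZeros u) (padZeros v)) (2 * u.length)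

@[simp]
theorem length_interleaveList (u v : List Bool) : (interleaveList u v).length = 2 * u.length :=
  length_initSeg _ _

theorem padZeros_append_of_lt {u : List Bool} (x : List Bool) {i : ℕ} (h : i < u.length) :
    padZeros (u ++ x) i = padZeros u i := by
  simp [padZeros, List.getElem?_append_left h]

theorem padZeros_append_length (u : List Bool) (a : Bool) : padZeros (u ++ [a]) u.length = a := by
  simp [padZeros]

theorem interleaveList_append {u v : List Bool} (h : u.length = v.length) (a b : Bool) :
    interleaveList (u ++ [a]) (v ++ [b]) = interleaveList u v ++ [a] ++ [b] := by
  have hl : 2 * (u ++ [a]).length = 2 * u.length + 1 + 1 := by simp; ring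
  rw [interleaveList, hl, initSeg_succ, initSeg_succ]
  congr 1
  · congr 1
    · refine initSeg_congr fun i hi => ?_
      have hu : i / 2 < u.length := by omega
      simp [interleave, padZeros_append_of_lt _ hu, padZeros_append_of_lt _ (h ▸ hu)]
    · simp [interleave, padZeros_append_length]
  · have h2 : (2 * u.length + 1) / 2 = v.length := by omega
    simp [interleave, h2, padZeros_append_length]

theorem interleaveList_initSeg (A B : BinSeq) (n : ℕ) :
    interleaveList (initSeg A n) (initSeg B n) = initSeg (interleave A B) (2 * n) := by
  rw [interleaveList, length_initSeg]
  refine initSeg_congr fun i hi => ?_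
  have h : i / 2 < n := by omega
  simp [interleave, padZeros_initSeg _ h]

/-- Fubini for strings: extending both coordinates by `n` bits extends the interleaving by `2 * n`.
-/
theorem extSum_extSum_interleaveList (f : List Bool → ℕ) (n : ℕ) {u v : List Bool}
    (h : u.length = v.length) :
    extSum (fun y => extSum (fun x => f (interleaveList x y)) n u) n v =
      extSum f (2 * n) (interleaveList u v) := by
  induction n generalizing u v with
  | zero => rfl
  | succ n ih =>
    have hl (a b : Bool) : (u ++ [a]).length = (v ++ [b]).length := by simp [h]
    simp only [extSum, extSum_add, mul_add_one, ih (hl _ _), interleaveList_append h]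
    ring

/-- The sum of `f` over the interleavings of `v` with all strings of the same length. -/
def fiberSum (f : List Bool → ℕ) (v : List Bool) : ℕ :=
  extSum (fun u => f (interleaveList u v)) v.length []

section fiberSum

variable {f : List Bool → ℕ}

theorem primrec₂_interleaveList : Primrec₂ interleaveList := by
  refine primrec_initSeg ?_ (Primrec.nat_double.comp (Primrec.list_length.comp Primrec.fst))
  have hi : Primrec fun p : (List Bool × List Bool) × ℕ => p.2 / 2 :=
    Primrec.nat_div.comp Primrec.snd (Primrec.const 2)
  exact Primrec.ite (Primrec.eq.comp (Primrec.nat_mod.comp Primrec.snd (Primrec.const 2))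
    (Primrec.const 0)) (primrec₂_padZeros.comp (Primrec.fst.comp Primrec.fst) hi)
    (primrec₂_padZeros.comp (Primrec.snd.comp Primrec.fst) hi)

theorem computable_fiberSum (hc : Computable f) : Computable (fiberSum f) :=
  computable_extSum (hc.comp (primrec₂_interleaveList.to_comp.comp Computable.snd
    Computable.fst)).to₂ Computable.list_length (Computable.const [])

/-- One more bit in `v` doubles the number of strings summed over, and no value of `f` drops; so
fiber averages increase. -/
theorem two_mul_fiberSum_le (hf : ∀ w b, f w ≤ f (w ++ [b])) (v : List Bool) (b : Bool) :
    fiberSum f v * 2 ≤ fiberSum f (v ++ [b]) := by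
  unfold fiberSum
  rw [List.length_append, List.length_singleton, extSum_succ, ← extSum_mul_const]
  refine extSum_mono _ _ fun u hu => ?_
  have hl : u.length = v.length := by simpa using hu
  rw [interleaveList_append hl, interleaveList_append hl, mul_two]
  exact Nat.add_le_add ((hf _ _).trans (hf _ _)) ((hf _ _).trans (hf _ _))

theorem extSum_fiberSum (f : List Bool → ℕ) (n : ℕ) :
    extSum (fiberSum f) n [] = extSum f (2 * n) [] := by
  rw [← show interleaveList [] [] = [] from rfl, ← extSum_extSum_interleaveList f n rfl]
  refine extSum_congr _ _ fun v hv => ?_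
  have hl : v.length = n := by simpa using hv
  rw [fiberSum, hl]

/-- The integer part of the average of `f` over the interleavings of `v` with strings of the same
length. -/
def fiberAverage (f : List Bool → ℕ) (v : List Bool) : ℕ := fiberSum f v / 2 ^ v.length

theorem computable_fiberAverage (hc : Computable f) : Computable (fiberAverage f) :=
  Primrec.nat_div.to_comp.comp (computable_fiberSum hc)
    (primrec₂_pow.to_comp.comp (Computable.const 2) Computable.list_length)

theorem fiberAverage_le_append (hf : ∀ w b, f w ≤ f (w ++ [b])) (v : List Bool) (b : Bool) :
    fiberAverage f v ≤ fiberAverage f (v ++ [b]) := by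
  unfold fiberAverage
  rw [List.length_append, List.length_singleton, pow_succ,
    ← Nat.mul_div_mul_right _ (2 ^ v.length) two_pos]
  exact Nat.div_le_div_right (two_mul_fiberSum_le hf v b)

theorem extSum_fiberAverage_le {C : ℕ} (hC : ∀ n, extSum f n [] ≤ C * 2 ^ n) (n : ℕ) :
    extSum (fiberAverage f) n [] ≤ C * 2 ^ n := by
  refine Nat.le_of_mul_le_mul_right ?_ (Nat.two_pow_pos n)
  rw [← extSum_mul_const]
  calc extSum (fun x => fiberAverage f x * 2 ^ n) n [] ≤ extSum (fiberSum f) n [] := by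
        refine extSum_mono _ _ fun v hv => ?_
        have hl : v.length = n := by simpa using hv
        rw [fiberAverage, hl]
        exact Nat.div_mul_le_self _ _
    _ = extSum f (2 * n) [] := extSum_fiberSum f n
    _ ≤ C * 2 ^ (2 * n) := hC _
    _ = C * 2 ^ n * 2 ^ n := by ring

/-! ### Cutting off where the fiber average is bounded -/

/-- The largest `m ≤ n` such that the average of `f` over the interleavings of `Y₀ … Yₘ₋₁` with
strings of length `m` is at most `c`. -/
def lastBounded (f : List Bool → ℕ) (c : ℕ) (Y : BinSeq) (n : ℕ) : ℕ :=
  Nat.rec 0 (fun m k => if fiberSum f (initSeg Y (m + 1)) ≤ c * 2 ^ (m + 1) then m + 1 else k) n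

theorem lastBounded_succ (f : List Bool → ℕ) (c : ℕ) (Y : BinSeq) (n : ℕ) :
    lastBounded f c Y (n + 1) =
      if fiberSum f (initSeg Y (n + 1)) ≤ c * 2 ^ (n + 1) then n + 1 else lastBounded f c Y n :=
  rfl

theorem lastBounded_le (f : List Bool → ℕ) (c : ℕ) (Y : BinSeq) (n : ℕ) :
    lastBounded f c Y n ≤ n := by
  induction n with
  | zero => rfl
  | succ n ih =>
    rw [lastBounded_succ]
    split_ifs
    · rfl
    · omega

theorem fiberSum_lastBounded_le (h0 : f [] = 0) (c : ℕ) (Y : BinSeq) (n : ℕ) :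
    fiberSum f (initSeg Y (lastBounded f c Y n)) ≤ c * 2 ^ lastBounded f c Y n := by
  induction n with
  | zero => exact (show fiberSum f [] = 0 from h0).trans_le (Nat.zero_le _)
  | succ n ih =>
    rw [lastBounded_succ]
    split_ifs with h
    · exact h
    · exact ih

theorem lastBounded_eq_self {c : ℕ} {Y : BinSeq}
    (h : ∀ n, fiberSum f (initSeg Y n) ≤ c * 2 ^ n) (n : ℕ) : lastBounded f c Y n = n := by
  cases n with
  | zero => rfl
  | succ n => rw [lastBounded_succ, if_pos (h _)]

theorem lastBounded_congr {c : ℕ} {Y Z : BinSeq} {n : ℕ} (h : ∀ i < n, Y i = Z i) :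
    lastBounded f c Y n = lastBounded f c Z n := by
  induction n with
  | zero => rfl
  | succ n ih =>
    rw [lastBounded_succ, lastBounded_succ, initSeg_congr h, ih fun i hi => h i (by omega)]

theorem computable_lastBounded (hc : Computable f) (c : ℕ) :
    Computable₂ fun (y : List Bool) n => lastBounded f c (padZeros y) n := by
  have hs : Computable fun p : (List Bool × ℕ) × (ℕ × ℕ) => p.2.1 + 1 :=
    Computable.succ.comp (Computable.fst.comp Computable.snd)
  have hi : Primrec₂ fun (y : List Bool) n => initSeg (padZeros y) n :=
    primrec_initSeg (primrec₂_padZeros.comp (Primrec.fst.comp Primrec.fst) Primrec.snd) Primrec.snd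
  have hd : Computable fun p : (List Bool × ℕ) × (ℕ × ℕ) =>
      decide (fiberSum f (initSeg (padZeros p.1.1) (p.2.1 + 1)) ≤ c * 2 ^ (p.2.1 + 1)) :=
    (primrecRel_iff_primrec_decide.1 Primrec.nat_le).to_comp.comp
      ((computable_fiberSum hc).comp (hi.to_comp.comp (Computable.fst.comp Computable.fst) hs))
      (Primrec.nat_mul.to_comp.comp (Computable.const c)
        (primrec₂_pow.to_comp.comp (Computable.const 2) hs))
  refine (Computable.nat_rec (f := fun p : List Bool × ℕ => p.2) (g := fun _ => 0)
    (h := fun p q => cond (decide (fiberSum f (initSeg (padZeros p.1) (q.1 + 1)) ≤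
      c * 2 ^ (q.1 + 1))) (q.1 + 1) q.2) Computable.snd (Computable.const 0)
    (Computable.cond hd hs (Computable.snd.comp Computable.snd))).of_eq fun p => ?_
  simp only [lastBounded, Bool.cond_decide]

/-- The value of `f` on the interleaving of `u` with `Y`, cut off at the last length at which the
average for `Y` is at most `c`. -/
def fiberValue (f : List Bool → ℕ) (c : ℕ) (Y : BinSeq) (u : List Bool) : ℕ :=
  f (interleaveList (u.take (lastBounded f c Y u.length)) (initSeg Y (lastBounded f c Y u.length)))

theorem computable_fiberValue (hc : Computable f) (c : ℕ) :
    Computable₂ fun y u => fiberValue f c (padZeros y) u := by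
  have hm : Computable fun p : List Bool × List Bool =>
      lastBounded f c (padZeros p.1) p.2.length :=
    (computable_lastBounded hc c).comp Computable.fst (Computable.list_length.comp Computable.snd)
  have hi : Primrec₂ fun (y : List Bool) n => initSeg (padZeros y) n :=
    primrec_initSeg (primrec₂_padZeros.comp (Primrec.fst.comp Primrec.fst) Primrec.snd) Primrec.snd
  exact hc.comp (primrec₂_interleaveList.to_comp.comp
    (Primrec.list_take.to_comp.comp hm Computable.snd) (hi.to_comp.comp Computable.fst hm))

theorem fiberValue_congr {c : ℕ} {Y Z : BinSeq} {u : List Bool} (h : ∀ i < u.length, Y i = Z i) :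
    fiberValue f c Y u = fiberValue f c Z u := by
  unfold fiberValue
  rw [lastBounded_congr h,
    initSeg_congr fun i hi => h i (hi.trans_le (lastBounded_le f c Z u.length))]

theorem fiberValue_le_append (hf : ∀ w b, f w ≤ f (w ++ [b])) (c : ℕ) (Y : BinSeq) (u : List Bool)
    (b : Bool) : fiberValue f c Y u ≤ fiberValue f c Y (u ++ [b]) := by
  -- The two cut-offs may differ by many bits, so monotonicity is proved bit pair by bit pair. The
  -- `min` keeps the two strings of equal length.
  have hm : Monotone fun n =>
      f (interleaveList ((u ++ [b]).take (min n (u.length + 1)))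
        (initSeg Y (min n (u.length + 1)))) := by
    refine monotone_nat_of_le_succ fun n => ?_
    rcases lt_or_ge n (u.length + 1) with h | h
    · rw [min_eq_left h.le, min_eq_left h, initSeg_succ,
        List.take_succ_eq_append_getElem (by simpa using h), interleaveList_append]
      · exact (hf _ _).trans (hf _ _)
      · simp; omega
    · rw [min_eq_right h, min_eq_right (h.trans n.le_succ)]
  have h1 := lastBounded_le f c Y u.length
  have h2 := lastBounded_le f c Y (u.length + 1)
  have h3 : lastBounded f c Y u.length ≤ lastBounded f c Y (u.length + 1) := by
    rw [lastBounded_succ]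
    split_ifs
    · omega
    · rfl
  have h := hm h3
  simp only [min_eq_left h2, min_eq_left (h1.trans u.length.le_succ),
    List.take_append_of_le_length h1] at h
  simpa [fiberValue] using h

/-- At length `n` the cut-off `m` is the same for all strings, so the average is the fiber average
at `m`, which is at most `c` for every oracle. -/
theorem extSum_fiberValue_le (h0 : f [] = 0) (c : ℕ) (Y : BinSeq) (n : ℕ) :
    extSum (fiberValue f c Y) n [] ≤ c * 2 ^ n := by
  obtain ⟨k, hk⟩ := Nat.exists_eq_add_of_le (lastBounded_le f c Y n)
  have hs := fiberSum_lastBounded_le h0 c Y n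
  generalize hm : lastBounded f c Y n = m at hk hs
  have h : extSum (fiberValue f c Y) n [] =
      extSum (fun u => f (interleaveList (u.take m) (initSeg Y m))) n [] := by
    refine extSum_congr _ _ fun u hu => ?_
    have hl : u.length = n := by simpa using hu
    rw [fiberValue, hl, hm]
  rw [h, hk, extSum_take (fun u => f (interleaveList u (initSeg Y m)))]
  rw [fiberSum, length_initSeg] at hs
  calc _ ≤ 2 ^ k * (c * 2 ^ m) := Nat.mul_le_mul_left _ hs
    _ = _ := by ring

end fiberSum

/-! ### The dichotomy for `B` -/

theorem not_mlRandom_of_unbounded {f : List Bool → ℕ} (hc : Computable f)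
    (hf : ∀ w b, f w ≤ f (w ++ [b])) {C : ℕ} (hC : ∀ n, extSum f n [] ≤ C * 2 ^ n) {X : BinSeq}
    (hX : ∀ c, ∃ n, c < f (initSeg X n)) : ¬ MLRandom X :=
  not_not_intro ⟨limitAverage f, .inr (isSupermartingale_limitAverage hf hC),
    isCE_limitAverage hc hf hC, succeeds_limitAverage hf hC hX⟩

theorem not_mlRandom_or_of_unbounded {f : List Bool → ℕ} (hc : Computable f)
    (hf : ∀ w b, f w ≤ f (w ++ [b])) (h0 : f [] = 0) {C : ℕ}
    (hC : ∀ n, extSum f n [] ≤ C * 2 ^ n) {A B : BinSeq}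
    (h : ∀ c, ∃ n, c < f (initSeg (interleave A B) n)) :
    ¬ MLRandom B ∨ ¬ MLRandomRelativeTo A B := by
  by_cases hB : ∀ c, ∃ n, c < fiberAverage f (initSeg B n)
  · exact .inl (not_mlRandom_of_unbounded (computable_fiberAverage hc) (fiberAverage_le_append hf)
      (extSum_fiberAverage_le hC) hB)
  push Not at hB
  obtain ⟨c, hB⟩ := hB
  -- `fiberAverage` is an integer part, so the true average is only below `c + 1`.
  have hB' (n : ℕ) : fiberSum f (initSeg B n) ≤ (c + 1) * 2 ^ n := by
    have h1 := hB n
    rw [fiberAverage, length_initSeg, ← Nat.lt_succ_iff, Nat.div_lt_iff_lt_mul (by positivity)] at h1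
    exact h1.le
  have hmono : Monotone fun n => f (initSeg (interleave A B) n) :=
    monotone_nat_of_le_succ fun n => by rw [initSeg_succ]; exact hf _ _
  refine .inr (not_not_intro ⟨fun Y => limitAverage (fiberValue f (c + 1) Y),
    .inr fun Y => isSupermartingale_limitAverage (fiberValue_le_append hf _ Y)
      (extSum_fiberValue_le h0 _ Y),
    isOracleCE_limitAverage (computable_fiberValue hc _) (fun _ _ _ => fiberValue_congr)
      (fiberValue_le_append hf _) (extSum_fiberValue_le h0 _),
    succeeds_limitAverage (fiberValue_le_append hf _ B) (extSum_fiberValue_le h0 _ B)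
      fun k => ?_⟩)
  obtain ⟨n, hn⟩ := h k
  refine ⟨n, hn.trans_le ?_⟩
  rw [fiberValue, length_initSeg, lastBounded_eq_self hB', take_initSeg A le_rfl,
    interleaveList_initSeg]
  exact hmono (by omega)

/-! ### A computable substitute for the running maximum -/

/-- A lower bound for `maxLog d w` computed from approximations `M` of `d`, with `|w|` many of them
taken into account. -/
def approxMaxLog (M : List Bool → ℕ → ℤ × ℕ) (w : List Bool) : ℕ :=
  (Finset.range w.length).sup fun i =>
    Nat.log 2 ((M (w.take i.unpair.1) i.unpair.2).1.toNat /
      ((M (w.take i.unpair.1) i.unpair.2).2 + 1))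

section approxMaxLog

variable {M : List Bool → ℕ → ℤ × ℕ} {d : List Bool → ℝ≥0}

theorem computable_approxMaxLog (hM : Computable₂ M) : Computable (approxMaxLog M) := by
  have h : Computable fun p : List Bool × ℕ => M (p.1.take p.2.unpair.1) p.2.unpair.2 :=
    hM.comp (Primrec.list_take.to_comp.comp
      (Computable.fst.comp (Computable.unpair.comp Computable.snd)) Computable.fst)
      (Computable.snd.comp (Computable.unpair.comp Computable.snd))
  exact computable_sup Computable.list_length (primrec_natLog_two.to_comp.comp
    (Primrec.nat_div.to_comp.comp (primrec_toNat.to_comp.comp (Computable.fst.comp h))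
      (Computable.succ.comp (Computable.snd.comp h))))

/-- An index `i < |w|` codes a prefix length and a stage; that length is at most `i`, so appending a
bit leaves the old terms unchanged and adds one. -/
theorem approxMaxLog_le_append (w : List Bool) (b : Bool) :
    approxMaxLog M w ≤ approxMaxLog M (w ++ [b]) := by
  refine Finset.sup_le fun i hi => ?_
  have hi' := Finset.mem_range.1 hi
  have hj : i.unpair.1 ≤ w.length := (Nat.unpair_left_le i).trans hi'.le
  have hmem : i ∈ Finset.range (w ++ [b]).length := by simp; omega
  have h := Finset.le_sup (f := fun i => Nat.log 2 ((M ((w ++ [b]).take i.unpair.1) i.unpair.2).1.toNat /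
      ((M ((w ++ [b]).take i.unpair.1) i.unpair.2).2 + 1))) hmem
  simp only [List.take_append_of_le_length hj] at h
  exact h

theorem floor_ratValue_le (hd : ApproximatesFromBelow M d) (w : List Bool) (n : ℕ) :
    (M w n).1.toNat / ((M w n).2 + 1) ≤ ⌊d w⌋₊ := by
  obtain ⟨hmono, hlim⟩ := hd w
  have hmono' : Monotone fun n => (ratValue (M w n) : ℝ) := fun a b hab => by
    exact Rat.cast_le.2 (hmono hab)
  have h := hmono'.ge_of_tendsto hlim n
  rw [Nat.le_floor_iff (zero_le (a := d w)), ← NNReal.coe_le_coe]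
  -- A negative approximation is truncated to 0, hence the comparison with the maximum of the
  -- approximation and 0.
  refine le_trans ?_ (max_le h (d w).coe_nonneg)
  rw [NNReal.coe_natCast]
  refine Nat.cast_div_le.trans ?_
  simp only [ratValue]
  rcases le_total 0 (M w n).1 with h0 | h0
  · refine le_max_of_le_left (le_of_eq ?_)
    have : (((M w n).1.toNat : ℤ) : ℝ) = (M w n).1 := by rw [Int.toNat_of_nonneg h0]
    push_cast at this ⊢
    rw [← this]
  · refine le_max_of_le_right (le_of_eq ?_)
    rw [Int.toNat_of_nonpos h0]
    simp

theorem approxMaxLog_le_maxLog (hd : ApproximatesFromBelow M d) (w : List Bool) :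
    approxMaxLog M w ≤ maxLog d w := by
  refine Finset.sup_le fun i hi => ?_
  have hmem : i.unpair.1 ∈ Finset.range (w.length + 1) := by
    have := Nat.unpair_left_le i
    simp at hi ⊢; omega
  exact (Nat.log_mono_right (floor_ratValue_le hd _ _)).trans
    (Finset.le_sup (f := fun j => Nat.log 2 ⌊d (w.take j)⌋₊) hmem)

theorem exists_extSum_approxMaxLog_le (hd : ApproximatesFromBelow M d) (hs : IsSupermartingale d) :
    ∃ C : ℕ, ∀ n, extSum (approxMaxLog M) n [] ≤ C * 2 ^ n := by
  obtain ⟨C, hC⟩ := exists_nat_ge ((maxLog d [] : ℝ) + d [] / 2 ^ maxLog d [])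
  refine ⟨C, fun n => (extSum_mono n [] fun x _ => approxMaxLog_le_maxLog hd x).trans ?_⟩
  have h := (extSum_maxLog_le hs n []).trans (mul_le_mul_of_nonneg_left hC (by positivity))
  rw [mul_comm]
  exact_mod_cast h

theorem exists_lt_approxMaxLog (hd : ApproximatesFromBelow M d) {X : BinSeq} (hX : Succeeds d X)
    (c : ℕ) : ∃ n, c < approxMaxLog M (initSeg X n) := by
  obtain ⟨n, hn⟩ := hX.exists_lt (2 ^ (c + 1))
  obtain ⟨t, ht⟩ := ((hd (initSeg X n)).2.eventually
    (lt_mem_nhds (show ((2 : ℝ) ^ (c + 1)) < d (initSeg X n) by exact_mod_cast hn))).exists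
  -- At this length the index coding prefix length `n` and stage `t` has just been taken into
  -- account.
  refine ⟨Nat.pair n t + 1, ?_⟩
  have h := Finset.le_sup (f := fun i => Nat.log 2 ((M ((initSeg X (Nat.pair n t + 1)).take
    i.unpair.1) i.unpair.2).1.toNat / ((M ((initSeg X (Nat.pair n t + 1)).take
    i.unpair.1) i.unpair.2).2 + 1)))
    (Finset.mem_range.2 (show Nat.pair n t < (initSeg X (Nat.pair n t + 1)).length by simp))
  simp only [Nat.unpair_pair,
    take_initSeg X ((Nat.left_le_pair n t).trans (Nat.le_succ _))] at h
  refine lt_of_lt_of_le ?_ h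
  generalize M (initSeg X n) t = p at ht
  have h1 : ((2 : ℚ) ^ (c + 1)) < ratValue p := by exact_mod_cast ht
  rw [ratValue, lt_div_iff₀ (by positivity)] at h1
  have h2 : (2 ^ (c + 1) * (p.2 + 1) : ℤ) < p.1 := by exact_mod_cast h1
  have h3 : 2 ^ (c + 1) * (p.2 + 1) ≤ p.1.toNat := by
    zify
    exact h2.le.trans (Int.self_le_toNat _)
  exact Nat.le_log_of_pow_le one_lt_two ((Nat.le_div_iff_mul_le (Nat.succ_pos _)).2 h3)

end approxMaxLog

end VanLambalgen

theorem mainTheorem11 (A B : VanLambalgen.BinSeq)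
    (h : ¬ VanLambalgen.MLRandom (VanLambalgen.interleave A B)) :
    ¬ VanLambalgen.MLRandom B ∨ ¬ VanLambalgen.MLRandomRelativeTo A B := by
  obtain ⟨d, hd, ⟨M, hM, hMd⟩, hX⟩ := not_not.1 h
  have hs : VanLambalgen.IsSupermartingale d := hd.elim (fun h => h.isSupermartingale) id
  obtain ⟨C, hC⟩ := VanLambalgen.exists_extSum_approxMaxLog_le hMd hs
  exact VanLambalgen.not_mlRandom_or_of_unbounded (VanLambalgen.computable_approxMaxLog hM)
    VanLambalgen.approxMaxLog_le_append rfl hC (VanLambalgen.exists_lt_approxMaxLog hMd hX)
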